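/- Setting. Base stations form a homogeneous Poisson point process $\Psi=\{x_i\}$ on $\mathbb{R}^2$ with intensity $\lambda_0>0$; put $r_i=|x_i|$, and let $r_0=\min_i r_i$ be the distance from the origin to the closest base station. The base stations carry fading gains $h_i\ge 0$ with an arbitrary common law of mean $1$ and path losses $L_i(\cdot)$ that are copies of a (deterministic or random) measurable function $L:\mathbb{R}_+\to\mathbb{R}_+$. The pairs $(h_i,L_i)$ are i.i.d. and independent of $\Psi$, and $h_i$ is independent of $L_i$. (If $L$ is deterministic, then $L_i=L$ for every $i$.) The path loss is physically feasible: $L(0)=L_0$ is a finite constant, $L(r)\le L_0$ for all $r\ge 0$, and $0<\gamma:=\mathbb{E}\left[\int_0^\infty rL(r)\,dr\right]<\infty$. The interference at the origin is $$\mathcal{I}=\sum_{i:\,r_i>r_0} h_i L_i(r_i).$$ Corollary 1. Let $\lambda_c\ge 0$ be a constant, and suppose that at least one of the following two conditions holds, where $(h,L)$ has the law of $(h_i,L_i)$ and $\mathbb{E}$, $\mathbb{P}$ are with respect to $h$ (and to $L$, if $L$ is random): 1. for all $\lambda_0\ge\lambda_c$ with $\lambda_0>0$, $$\int_0^\infty\!\int_0^\infty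 2\pi\lambda_0\, r\,t\,\exp\left(-\pi\lambda_0 r^2-2\pi\lambda_0\int_r^\infty x\,\mathbb{E}\left[1-e^{-htL(x)}\right]dx\right)dr\,dt<\infty;$$ 2. for all $\lambda_0\ge\lambda_c$ with $\lambda_0>0$, $$\int_0^\infty\!\int_0^\infty 2\pi\lambda_0\, r\,\exp\left(-\pi\lambda_0 r^2-2\pi\lambda_0\int_r^\infty x\,\mathbb{P}\left(L(x)h\ge\tfrac{1}{\sqrt t}\right)dx\right)dr\,dt<\infty.$$ Then the second negative moment of the interference is finite, $\mathbb{E}\left[\mathcal{I}^{-2}\right]<\infty$, for all $\lambda_0\ge\lambda_c$ with $\lambda_0>0$. -/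

import Mathlib

open MeasureTheory ProbabilityTheory Set

noncomputable section

/-- The plane, with its Euclidean norm and Lebesgue measure. -/
abbrev Plane : Type := EuclideanSpace ℝ (Fin 2)

/-- The random counting measure `B ↦ #{i : X i ω ∈ B}` of the points `X 0 ω, X 1 ω, …`,
counted with multiplicity. -/
def pointCount {Ω : Type*} (X : ℕ → Ω → Plane) (ω : Ω) : Measure Plane :=
  Measure.sum fun i => Measure.dirac (X i ω)

/-- The points `X 0, X 1, …` form a homogeneous Poisson point process on the plane with
intensity `lam > 0`: the number of points in a Borel set of finite area is Poisson distributed with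
mean `lam` times the area, and the numbers of points in disjoint Borel sets are independent. (Such a
process has infinitely many points almost surely, so it is enumerated by `ℕ`; the enumeration
is arbitrary.) -/
structure IsPoissonProcess {Ω : Type*} [MeasurableSpace Ω] (P : Measure Ω)
    (lam : ℝ) (X : ℕ → Ω → Plane) : Prop where
  measurable : ∀ i, Measurable (X i)
  law : ∀ B : Set Plane, MeasurableSet B → volume B ≠ ⊤ →
    HasLaw (fun ω => pointCount X ω B)
      ((poissonMeasure (ENNReal.ofReal lam * volume B).toNNReal).map
        (fun k : ℕ => (k : ENNReal))) P
  indep : ∀ (n : ℕ) (B : Fin n → Set Plane), (∀ k, MeasurableSet (B k)) →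
    Pairwise (fun j k => Disjoint (B j) (B k)) →
    iIndepFun (fun k ω => pointCount X ω (B k)) P

/-- The network: base stations at the points of a homogeneous Poisson process of intensity `lam`,
and for the `i`-th base station the mark `M i = (hᵢ, sᵢ)` consisting of its fading gain `hᵢ` and the
state `sᵢ` of its link. The marks are i.i.d. and independent of the positions; `hᵢ` has law `μ`,
`sᵢ` has law `ν`, and the two are independent. -/
structure IsNetwork {Ω S : Type*} [MeasurableSpace Ω] [MeasurableSpace S] (P : Measure Ω)
    (lam : ℝ) (μ : Measure ℝ) (ν : Measure S) (X : ℕ → Ω → Plane) (M : ℕ → Ω → ℝ × S) : Prop where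
  poisson : IsPoissonProcess P lam X
  measurable_mark : ∀ i, Measurable (M i)
  law_mark : ∀ i, HasLaw (M i) (μ.prod ν) P
  indep_mark : iIndepFun M P
  indep_points_marks : IndepFun (fun ω i => X i ω) (fun ω i => M i ω) P

/-- The distance `r₀` from the origin to the closest base station. -/
def nearestDist {Ω : Type*} (X : ℕ → Ω → Plane) (ω : Ω) : ℝ :=
  ⨅ i, ‖X i ω‖

/-- The interference `∑ hᵢ L(rᵢ)` at the origin, the sum being over all base stations outside
the closed ball of radius `r₀`, that is, all but the closest one. Here `L s r` is the path loss at
distance `r` of a link in state `s`. -/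
def interference {Ω S : Type*} (L : S → ℝ → ℝ) (X : ℕ → Ω → Plane) (M : ℕ → Ω → ℝ × S)
    (ω : Ω) : ENNReal :=
  ∑' i, if nearestDist X ω < ‖X i ω‖ then
    ENNReal.ofReal ((M i ω).1 * L (M i ω).2 ‖X i ω‖) else 0

/-- The second negative moment `𝔼[I⁻²]` of the interference; it is infinite if `I` vanishes with
positive probability. -/
def secondNegMoment {Ω S : Type*} [MeasurableSpace Ω] (P : Measure Ω) (L : S → ℝ → ℝ)
    (X : ℕ → Ω → Plane) (M : ℕ → Ω → ℝ × S) : ENNReal :=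
  ∫⁻ ω, (interference L X M ω)⁻¹ ^ 2 ∂P

/-- `γ = 𝔼[∫₀^∞ r L(r) dr]`, the expectation being over the link state. -/
def pathLossGamma {S : Type*} [MeasurableSpace S] (ν : Measure S) (L : S → ℝ → ℝ) : ENNReal :=
  ∫⁻ s, (∫⁻ r in Ioi (0 : ℝ), ENNReal.ofReal (r * L s r)) ∂ν

/-- Physically feasible path loss: nonnegative, equal to the constant `L₀` at distance `0`, nowhere
above `L₀`, and with `0 < γ < ∞`. The path loss at distance `r` may depend on the random state `s`
of the link, of law `ν`; a path loss that is deterministic with the distance is one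
that does not depend on `s`. -/
structure IsFeasiblePathLoss {S : Type*} [MeasurableSpace S] (ν : Measure S) (L : S → ℝ → ℝ) :
    Prop where
  measurable : Measurable (Function.uncurry L)
  bounded : ∃ L₀ : ℝ, ∀ᵐ s ∂ν, L s 0 = L₀ ∧ ∀ r, 0 ≤ r → 0 ≤ L s r ∧ L s r ≤ L₀
  gamma_pos : 0 < pathLossGamma ν L
  gamma_finite : pathLossGamma ν L < ⊤

/-- The double integral with the Laplace transform of the fading. -/
def laplaceIntegral {S : Type*} [MeasurableSpace S] (μ : Measure ℝ) (ν : Measure S)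
    (L : S → ℝ → ℝ) (lam : ℝ) : ENNReal :=
  ∫⁻ t in Ioi (0 : ℝ), ∫⁻ r in Ioi (0 : ℝ), ENNReal.ofReal
    (2 * Real.pi * lam * r * t *
      Real.exp (-Real.pi * lam * r ^ 2 - 2 * Real.pi * lam *
        ∫ x in Ioi r, x * ∫ m : ℝ × S, (1 - Real.exp (-(m.1 * t * L m.2 x))) ∂(μ.prod ν)))

/-- The double integral with the tail probabilities `ℙ(L(x) h ≥ 1/√t)`. -/
def tailIntegral {S : Type*} [MeasurableSpace S] (μ : Measure ℝ) (ν : Measure S)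
    (L : S → ℝ → ℝ) (lam : ℝ) : ENNReal :=
  ∫⁻ t in Ioi (0 : ℝ), ∫⁻ r in Ioi (0 : ℝ), ENNReal.ofReal
    (2 * Real.pi * lam * r *
      Real.exp (-Real.pi * lam * r ^ 2 - 2 * Real.pi * lam *
        ∫ x in Ioi r, x * (μ.prod ν).real {m : ℝ × S | L m.2 x * m.1 ≥ 1 / Real.sqrt t}))

end

/-! Both conditions come from integrating a Laplace functional of the stations beyond the nearest
one. Condition 1 uses x⁻² = ∫ t e^{-tx} dt. Condition 2 uses 𝔼[I⁻²] = ∫ ℙ(I⁻² > t) dt, where a small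
sum forces every summand to be small. After Tonelli, each needs a bound on 𝔼[exp(-∑ ψ(rᵢ, mᵢ))] over
rᵢ > r₀, with ψ finite in the first case and 0 or ∞ in the second.

Conditioning on r₀ would evaluate this exactly, but finiteness needs it only up to a constant. Cut
the plane into shells √k ≤ |y| < √(k+1), all of area π. If r₀ lies in shell k, the disc inside is
empty, and dropping the shell's points only increases the exponential. What remains is a Laplace
functional with load ∞ on the disc and 0 on the shell (`expNeg_nearest_le_tsum_shellLoad`). Its
exponent is within λπ of the one that conditioning would give at any r in the shell
(`thinnedMean_le`). Averaging over r and summing over k costs the factor e^{λπ}/(λπ)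
(`IsNetwork.lintegral_expNeg_nearest_le`). -/

/-! ### The exponential on [0, ∞] and the Poisson law -/

/-- The function `x ↦ e⁻ˣ` on `[0, ∞]`, with `e^{-∞} = 0`. -/
noncomputable def expNeg (x : ENNReal) : ENNReal := EReal.exp (-(x : EReal))

/-- The inverse of `expNeg` on `[0, 1]`. -/
noncomputable def negLog (p : ENNReal) : ENNReal := (-(ENNReal.log p)).toENNReal

@[simp] lemma expNeg_zero : expNeg 0 = 1 := by simp [expNeg]

@[simp] lemma expNeg_top : expNeg ⊤ = 0 := by simp [expNeg]

lemma expNeg_antitone : Antitone expNeg := fun a b h => by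
  simpa [expNeg] using h

lemma continuous_expNeg : Continuous expNeg :=
  ENNReal.continuous_exp.comp (continuous_neg.comp continuous_coe_ennreal_ereal)

lemma measurable_expNeg : Measurable expNeg := continuous_expNeg.measurable

lemma expNeg_le_one (x : ENNReal) : expNeg x ≤ 1 := by
  simpa using expNeg_antitone (zero_le : 0 ≤ x)

lemma expNeg_add (x y : ENNReal) : expNeg (x + y) = expNeg x * expNeg y := by
  rw [expNeg, expNeg, expNeg, ← EReal.exp_add, EReal.coe_ennreal_add, EReal.neg_add]
  · rfl
  · simp
  · simp

lemma expNeg_sum {ι : Type*} (s : Finset ι) (f : ι → ENNReal) :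
    expNeg (∑ i ∈ s, f i) = ∏ i ∈ s, expNeg (f i) := by
  classical
  induction s using Finset.induction_on with
  | empty => simp
  | insert a s ha ih => rw [Finset.sum_insert ha, Finset.prod_insert ha, expNeg_add, ih]

lemma expNeg_natCast_mul (n : ℕ) (x : ENNReal) : expNeg (n * x) = expNeg x ^ n := by
  simpa using expNeg_sum (Finset.range n) fun _ => x

lemma expNeg_ofReal {a : ℝ} (ha : 0 ≤ a) :
    expNeg (ENNReal.ofReal a) = ENNReal.ofReal (Real.exp (-a)) := by
  rw [expNeg, EReal.coe_ennreal_ofReal, max_eq_left ha, ← EReal.coe_neg, EReal.exp_coe]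

lemma expNeg_le_ofReal_exp {a : ℝ} {x : ENNReal} (h : ENNReal.ofReal a ≤ x) :
    expNeg x ≤ ENNReal.ofReal (Real.exp (-a)) := by
  refine (expNeg_antitone h).trans ?_
  rcases le_total 0 a with ha | ha
  · rw [expNeg_ofReal ha]
  · rw [ENNReal.ofReal_of_nonpos ha, expNeg_zero, ENNReal.one_le_ofReal, Real.one_le_exp_iff]
    linarith

lemma expNeg_negLog {p : ENNReal} (hp : p ≤ 1) : expNeg (negLog p) = p := by
  have : 0 ≤ -ENNReal.log p := by
    rw [EReal.neg_nonneg, ENNReal.log_le_zero_iff]; exact hp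
  rw [expNeg, negLog, EReal.coe_toENNReal this, neg_neg, ENNReal.exp_log]

lemma measurable_negLog : Measurable negLog := by
  unfold negLog
  exact (measurable_id.ennreal_log.neg).ereal_toENNReal

lemma expNeg_tsum_tendsto (f : ℕ → ENNReal) :
    Filter.Tendsto (fun n => expNeg (∑ i ∈ Finset.range n, f i)) Filter.atTop
      (nhds (expNeg (∑' i, f i))) :=
  (continuous_expNeg.tendsto _).comp (ENNReal.tendsto_nat_tsum f)

/-- The generating function e^{-m(1-s)} at s = e^{-c}. For c = ∞ it is the void probability, since 0
· ∞ = 0 and 0⁰ = 1. -/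
lemma lintegral_expNeg_poissonMeasure (m : NNReal) (c : ENNReal) :
    ∫⁻ k, expNeg (k * c) ∂(poissonMeasure m) = expNeg (m * (1 - expNeg c)) := by
  obtain ⟨s, hs0, hs1, hs⟩ : ∃ s : ℝ, 0 ≤ s ∧ s ≤ 1 ∧ expNeg c = ENNReal.ofReal s := by
    have h1 := expNeg_le_one c
    have h2 : expNeg c ≠ ⊤ := ne_top_of_le_ne_top ENNReal.one_ne_top h1
    exact ⟨(expNeg c).toReal, ENNReal.toReal_nonneg,
      by simpa using ENNReal.toReal_mono ENNReal.one_ne_top h1, (ENNReal.ofReal_toReal h2).symm⟩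
  simp_rw [expNeg_natCast_mul, hs]
  have hsum : HasSum (fun k : ℕ => Real.exp (-m) * (m * s) ^ k / k.factorial)
      (Real.exp (-(m * (1 - s)))) := by
    have h := (NormedSpace.expSeries_div_hasSum_exp (m * s : ℝ)).mul_left (Real.exp (-m))
    rw [← Real.exp_eq_exp_ℝ, ← Real.exp_add, show -(m : ℝ) + m * s = -(m * (1 - s)) by ring] at h
    simpa only [mul_div_assoc] using h
  rw [lintegral_countable']
  simp_rw [poissonMeasure_singleton]
  have h1 : (m : ENNReal) * (1 - ENNReal.ofReal s) = ENNReal.ofReal (m * (1 - s)) := by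
    rw [ENNReal.ofReal_mul m.coe_nonneg, ENNReal.ofReal_sub _ hs0]; simp
  rw [h1, expNeg_ofReal (mul_nonneg m.coe_nonneg (by linarith)), ← hsum.tsum_eq,
    ENNReal.ofReal_tsum_of_nonneg (fun k => by positivity) hsum.summable]
  congr 1 with k
  rw [← ENNReal.ofReal_pow hs0, ← ENNReal.ofReal_mul (by positivity)]
  congr 1
  rw [mul_pow]; ring

/-! ### Polar coordinates and Laplace functionals -/

lemma lintegral_fun_norm_plane {f : ℝ → ENNReal} (hf : Measurable f) :
    ∫⁻ y : Plane, f ‖y‖ = ∫⁻ r in Ioi (0 : ℝ), ENNReal.ofReal (2 * Real.pi * r) * f r := by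
  have hmp := (volume : Measure Plane).measurePreserving_homeomorphUnitSphereProd
  have h0 : ∫⁻ y : Plane, f ‖y‖ = ∫⁻ y : ({0}ᶜ : Set Plane), f ‖(y : Plane)‖
      ∂(Measure.comap Subtype.val volume) := by
    rw [lintegral_subtype_comap (measurableSet_singleton _).compl (fun y : Plane => f ‖y‖),
      restrict_compl_singleton]
  have h1 : ∫⁻ y : ({0}ᶜ : Set Plane), f ‖(y : Plane)‖ ∂(Measure.comap Subtype.val volume)
      = ∫⁻ p : Metric.sphere (0 : Plane) 1 × Ioi (0 : ℝ), f p.2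
        ∂((volume : Measure Plane).toSphere.prod
          (Measure.volumeIoiPow (Module.finrank ℝ Plane - 1))) := by
    rw [← hmp.lintegral_comp (f := fun p => f p.2) (by fun_prop)]
    simp
  rw [h0, h1, lintegral_prod _ (by fun_prop)]
  simp only [lintegral_const]
  have h2 : (volume : Measure Plane).toSphere univ = ENNReal.ofReal (2 * Real.pi) := by
    rw [Measure.toSphere_apply_univ, EuclideanSpace.volume_ball_fin_two,
      ENNReal.ofReal_mul zero_le_two]
    simp [ENNReal.ofReal, Real.toNNReal_of_nonneg Real.pi_pos.le]
  rw [h2, Measure.volumeIoiPow, lintegral_withDensity_eq_lintegral_mul _ (by fun_prop)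
    (by fun_prop)]
  have h3 := lintegral_subtype_comap (μ := (volume : Measure ℝ)) (measurableSet_Ioi (a := (0:ℝ)))
    (fun r : ℝ => ENNReal.ofReal (r ^ (Module.finrank ℝ Plane - 1)) * f r)
  simp only [Pi.mul_apply]
  rw [h3, mul_comm, ← lintegral_const_mul _ (by fun_prop)]
  refine lintegral_congr fun r => ?_
  rw [← mul_assoc, ← ENNReal.ofReal_mul (by positivity)]
  simp

lemma lintegral_pointCount {Ω : Type*} (X : ℕ → Ω → Plane) (ω : Ω) {g : Plane → ENNReal}
    (hg : Measurable g) : ∫⁻ y, g y ∂(pointCount X ω) = ∑' i, g (X i ω) := by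
  simp [pointCount, lintegral_sum_measure, lintegral_dirac' _ hg]

lemma IsPoissonProcess.measurable_pointCount {Ω : Type*} [MeasurableSpace Ω] {P : Measure Ω}
    {lam : ℝ} {X : ℕ → Ω → Plane} (hX : IsPoissonProcess P lam X) {B : Set Plane}
    (hB : MeasurableSet B) : Measurable fun ω => pointCount X ω B := by
  simp_rw [pointCount, Measure.sum_apply _ hB]
  refine Measurable.tsum fun i => ?_
  exact (Measure.measurable_coe hB).comp (Measure.measurable_dirac.comp (hX.measurable i))

lemma IsPoissonProcess.lintegral_expNeg_mul_pointCount {Ω : Type*} [MeasurableSpace Ω]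
    {P : Measure Ω} {lam : ℝ} {X : ℕ → Ω → Plane} (hX : IsPoissonProcess P lam X)
    {B : Set Plane} (hB : MeasurableSet B) (hfin : volume B ≠ ⊤) (c : ENNReal) :
    ∫⁻ ω, expNeg (c * pointCount X ω B) ∂P =
      expNeg (ENNReal.ofReal lam * ((1 - expNeg c) * volume B)) := by
  have hm : Measurable fun x : ENNReal => expNeg (c * x) :=
    measurable_expNeg.comp (measurable_const_mul c)
  rw [(hX.law B hB hfin).lintegral_comp (f := fun x => expNeg (c * x)) hm.aemeasurable,
    lintegral_map hm (by fun_prop)]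
  simp_rw [mul_comm c]
  rw [lintegral_expNeg_poissonMeasure,
    ENNReal.coe_toNNReal (ENNReal.mul_ne_top ENNReal.ofReal_ne_top hfin)]
  ring_nf

/-- The level sets are disjoint, so their counts are independent and the exponential of the sum
factorises. The level set of 0 may have infinite area because it contributes nothing. -/
lemma IsPoissonProcess.lintegral_expNeg_simpleFunc {Ω : Type*} [MeasurableSpace Ω]
    {P : Measure Ω} [IsProbabilityMeasure P] {lam : ℝ} {X : ℕ → Ω → Plane}
    (hX : IsPoissonProcess P lam X) (g : SimpleFunc Plane ENNReal)
    (hg : ∀ c ≠ 0, volume (g ⁻¹' {c}) ≠ ⊤) :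
    ∫⁻ ω, expNeg (∫⁻ y, g y ∂(pointCount X ω)) ∂P =
      expNeg (ENNReal.ofReal lam * ∫⁻ y, (1 - expNeg (g y))) := by
  classical
  let e := g.range.equivFin
  have hind : iIndepFun (fun k ω => expNeg (((e.symm k : g.range) : ENNReal) *
      pointCount X ω (g ⁻¹' {((e.symm k : g.range) : ENNReal)}))) P := by
    refine (hX.indep _ (fun k => g ⁻¹' {((e.symm k : g.range) : ENNReal)})
      (fun k => g.measurableSet_fiber _) fun j k hjk => ?_).comp
      (fun k x => expNeg (((e.symm k : g.range) : ENNReal) * x))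
      (fun k => measurable_expNeg.comp (measurable_const_mul _))
    refine Disjoint.preimage _ ?_
    simpa [Subtype.ext_iff] using fun h => hjk (e.symm.injective (Subtype.ext h))
  have h1 : ∀ F : ENNReal → ENNReal,
      ∏ k : Fin g.range.card, F ((e.symm k : g.range) : ENNReal) = ∏ c ∈ g.range, F c := fun F => by
    rw [← Finset.prod_coe_sort g.range F]
    exact Equiv.prod_comp e.symm (fun c : g.range => F c)
  have h2 : ∀ c, ∫⁻ ω, expNeg (c * pointCount X ω (g ⁻¹' {c})) ∂P =
      expNeg (ENNReal.ofReal lam * ((1 - expNeg c) * volume (g ⁻¹' {c}))) := fun c => by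
    rcases eq_or_ne c 0 with rfl | hc
    · simp
    · exact hX.lintegral_expNeg_mul_pointCount (g.measurableSet_fiber _) (hg c hc) c
  have h3 := lintegral_prod_eq_prod_lintegral_of_indepFun Finset.univ _ hind fun k =>
    measurable_expNeg.comp ((hX.measurable_pointCount (g.measurableSet_fiber _)).const_mul _)
  simp_rw [h1 (fun c => ∫⁻ ω, expNeg (c * pointCount X ω (g ⁻¹' {c})) ∂P), h2] at h3
  have h4 : ∀ ω, expNeg (∫⁻ y, g y ∂(pointCount X ω)) =
      ∏ k : Fin g.range.card, expNeg (((e.symm k : g.range) : ENNReal) *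
        pointCount X ω (g ⁻¹' {((e.symm k : g.range) : ENNReal)})) := fun ω => by
    rw [h1 (fun c => expNeg (c * pointCount X ω (g ⁻¹' {c}))), SimpleFunc.lintegral_eq_lintegral,
      SimpleFunc.lintegral, expNeg_sum]
  simp_rw [h4]
  rw [h3, ← expNeg_sum, ← Finset.mul_sum]
  congr 2
  have h5 := SimpleFunc.lintegral_eq_lintegral (g.map fun c => 1 - expNeg c)
    (volume : Measure Plane)
  rw [SimpleFunc.map_lintegral] at h5
  exact h5.symm

/-- The Laplace functional of a Poisson process. -/
lemma IsPoissonProcess.lintegral_expNeg_tsum_le {Ω : Type*} [MeasurableSpace Ω]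
    {P : Measure Ω} [IsProbabilityMeasure P] {lam : ℝ} {X : ℕ → Ω → Plane}
    (hX : IsPoissonProcess P lam X) {g : Plane → ENNReal} (hg : Measurable g) :
    ∫⁻ ω, expNeg (∑' i, g (X i ω)) ∂P ≤
      expNeg (ENNReal.ofReal lam * ∫⁻ y, (1 - expNeg (g y))) := by
  -- Truncation to balls gives the nonzero level sets finite area and keeps the approximation
  -- increasing.
  let G : ℕ → SimpleFunc Plane ENNReal := fun n =>
    (SimpleFunc.eapprox g n).restrict (Metric.ball 0 n)
  have hball : ∀ n : ℕ, MeasurableSet (Metric.ball (0 : Plane) n) := fun n => measurableSet_ball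
  have hGapp : ∀ n y, G n y = (Metric.ball (0 : Plane) n).indicator (SimpleFunc.eapprox g n) y :=
    fun n y => by simp only [G]; rw [SimpleFunc.restrict_apply _ (hball n)]
  have hGle : ∀ n y, G n y ≤ g y := fun n y => by
    rw [hGapp]
    refine (indicator_le_self _ _ _).trans ?_
    rw [← SimpleFunc.iSup_eapprox_apply hg y]
    exact le_iSup (fun n => SimpleFunc.eapprox g n y) n
  have hGmono : ∀ y, Monotone fun n => G n y := fun y m n hmn => by
    simp only [hGapp]
    refine (indicator_le_indicator_of_subset (Metric.ball_subset_ball (by exact_mod_cast hmn))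
      (fun _ => zero_le) y).trans (indicator_le_indicator ?_)
    exact SimpleFunc.monotone_eapprox g hmn y
  have hGlim : ∀ y, Filter.Tendsto (fun n => G n y) Filter.atTop (nhds (g y)) := fun y => by
    refine (SimpleFunc.tendsto_eapprox hg y).congr' ?_
    obtain ⟨N, hN⟩ := exists_nat_gt ‖y‖
    filter_upwards [Filter.eventually_ge_atTop N] with n hn
    rw [hGapp, indicator_of_mem]
    simpa using hN.trans_le (by exact_mod_cast hn)
  have hfin : ∀ n, ∀ c ≠ 0, volume (G n ⁻¹' {c}) ≠ ⊤ := fun n c hc => by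
    refine ne_top_of_le_ne_top (measure_ball_lt_top (x := (0 : Plane)) (r := n)).ne
      (measure_mono fun y hy => ?_)
    by_contra h
    refine hc ?_
    rw [mem_preimage, mem_singleton_iff, hGapp, indicator_of_notMem h] at hy
    exact hy.symm
  have hbound : ∀ n, ∫⁻ ω, expNeg (∑' i, g (X i ω)) ∂P ≤
      expNeg (ENNReal.ofReal lam * ∫⁻ y, (1 - expNeg (G n y))) := fun n => by
    rw [← hX.lintegral_expNeg_simpleFunc (G n) (hfin n)]
    refine lintegral_mono fun ω => expNeg_antitone ?_
    rw [lintegral_pointCount X ω (G n).measurable]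
    exact ENNReal.tsum_le_tsum fun i => hGle n _
  suffices hlim : Filter.Tendsto (fun n => ∫⁻ y, (1 - expNeg (G n y))) Filter.atTop
      (nhds (∫⁻ y, (1 - expNeg (g y)))) from
    ge_of_tendsto' ((continuous_expNeg.tendsto _).comp
      (ENNReal.Tendsto.const_mul hlim (Or.inr ENNReal.ofReal_ne_top))) hbound
  refine lintegral_tendsto_of_tendsto_of_monotone (fun n => ?_) (ae_of_all _ fun y => ?_)
    (ae_of_all _ fun y => ?_)
  · exact (measurable_const.sub (measurable_expNeg.comp (G n).measurable)).aemeasurable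
  · exact fun m n hmn => tsub_le_tsub_left (expNeg_antitone (hGmono y hmn)) _
  · exact ENNReal.Tendsto.sub tendsto_const_nhds ((continuous_expNeg.tendsto _).comp (hGlim y))
      (Or.inl ENNReal.one_ne_top)

/-- The Laplace functional of an independently marked Poisson process. -/
lemma IsNetwork.lintegral_expNeg_tsum_le {Ω S : Type*} [MeasurableSpace Ω] [MeasurableSpace S]
    {P : Measure Ω} [IsProbabilityMeasure P] {lam : ℝ} {μ : Measure ℝ} {ν : Measure S}
    [IsProbabilityMeasure μ] [IsProbabilityMeasure ν]
    {X : ℕ → Ω → Plane} {M : ℕ → Ω → ℝ × S}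
    (hN : IsNetwork P lam μ ν X M) {φ : Plane → ℝ × S → ENNReal}
    (hφ : Measurable (Function.uncurry φ)) :
    ∫⁻ ω, expNeg (∑' i, φ (X i ω) (M i ω)) ∂P ≤
      expNeg (ENNReal.ofReal lam * ∫⁻ y, (1 - ∫⁻ m, expNeg (φ y m) ∂(μ.prod ν))) := by
  have hXm : Measurable fun ω i => X i ω := measurable_pi_lambda _ hN.poisson.measurable
  have hMm : Measurable fun ω i => M i ω := measurable_pi_lambda _ hN.measurable_mark
  have hφ' : ∀ y, Measurable (φ y) := fun y => hφ.comp measurable_prodMk_left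
  set F : Plane → ENNReal := fun y => ∫⁻ m, expNeg (φ y m) ∂(μ.prod ν)
  have hFm : Measurable F := Measurable.lintegral_prod_right' (measurable_expNeg.comp hφ)
  have hF1 : ∀ y, F y ≤ 1 := fun y => by
    simpa using lintegral_mono (μ := μ.prod ν) fun m => expNeg_le_one (φ y m)
  have hjoint : Measurable fun p : (ℕ → Plane) × (ℕ → ℝ × S) =>
      expNeg (∑' i, φ (p.1 i) (p.2 i)) := by
    refine measurable_expNeg.comp (Measurable.tsum fun i => ?_)
    have h : Measurable fun p : (ℕ → Plane) × (ℕ → ℝ × S) => (p.1 i, p.2 i) := by fun_prop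
    exact hφ.comp h
  -- With the positions frozen, the marks are independent and each factor averages to `F (x i)`.
  -- Writing it as the exponential of a load turns the marked functional into an unmarked one.
  have hcond : ∀ x : ℕ → Plane, ∫⁻ ω, expNeg (∑' i, φ (x i) (M i ω)) ∂P ≤
      expNeg (∑' i, negLog (F (x i))) := fun x => by
    refine ge_of_tendsto' (expNeg_tsum_tendsto _) fun n => ?_
    rw [expNeg_sum]
    simp_rw [expNeg_negLog (hF1 _)]
    calc ∫⁻ ω, expNeg (∑' i, φ (x i) (M i ω)) ∂P
        ≤ ∫⁻ ω, ∏ i ∈ Finset.range n, expNeg (φ (x i) (M i ω)) ∂P := by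
          refine lintegral_mono fun ω => ?_
          simp only
          rw [← expNeg_sum]
          exact expNeg_antitone (ENNReal.sum_le_tsum _)
      _ = ∏ i ∈ Finset.range n, ∫⁻ ω, expNeg (φ (x i) (M i ω)) ∂P :=
          lintegral_prod_eq_prod_lintegral_of_indepFun _ _
            (hN.indep_mark.comp (fun i m => expNeg (φ (x i) m))
              fun i => measurable_expNeg.comp (hφ' _))
            fun i => (measurable_expNeg.comp (hφ' _)).comp (hN.measurable_mark i)
      _ = ∏ i ∈ Finset.range n, F (x i) := by
          refine Finset.prod_congr rfl fun i _ => ?_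
          exact (hN.law_mark i).lintegral_comp (f := fun m => expNeg (φ (x i) m))
            (measurable_expNeg.comp (hφ' _)).aemeasurable
  calc ∫⁻ ω, expNeg (∑' i, φ (X i ω) (M i ω)) ∂P
      = ∫⁻ p, expNeg (∑' i, φ (p.1 i) (p.2 i))
          ∂(P.map fun ω => ((fun i => X i ω), fun i => M i ω)) :=
        (lintegral_map hjoint (hXm.prodMk hMm)).symm
    _ = ∫⁻ x, ∫⁻ m, expNeg (∑' i, φ (x i) (m i)) ∂(P.map fun ω i => M i ω)
          ∂(P.map fun ω i => X i ω) := by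
        have := Measure.isProbabilityMeasure_map (μ := P) hMm.aemeasurable
        rw [(indepFun_iff_map_prod_eq_prod_map_map hXm.aemeasurable hMm.aemeasurable).1
          hN.indep_points_marks, lintegral_prod _ hjoint.aemeasurable]
    _ ≤ ∫⁻ x, expNeg (∑' i, negLog (F (x i))) ∂(P.map fun ω i => X i ω) := by
        refine lintegral_mono fun x => ?_
        simp only
        exact (lintegral_map (hjoint.comp (measurable_prodMk_left (x := x))) hMm).trans_le (hcond x)
    _ = ∫⁻ ω, expNeg (∑' i, negLog (F (X i ω))) ∂P := by
        refine lintegral_map (measurable_expNeg.comp (Measurable.tsum fun i => ?_)) hXm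
        exact measurable_negLog.comp (hFm.comp (measurable_pi_apply i))
    _ ≤ _ := by
        refine (hN.poisson.lintegral_expNeg_tsum_le (measurable_negLog.comp hFm)).trans_eq ?_
        simp only [Function.comp_def, expNeg_negLog (hF1 _)]
        rfl

/-! ### Shells of equal area and the points beyond the nearest one -/

lemma lintegral_indicator_norm_lt (a : ℝ) :
    ∫⁻ y : Plane, (Iio a).indicator (1 : ℝ → ENNReal) ‖y‖ = ENNReal.ofReal a ^ 2 * ENNReal.ofReal Real.pi := by
  rw [← EuclideanSpace.volume_ball_fin_two 0 a, ← lintegral_indicator_one measurableSet_ball]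
  refine lintegral_congr fun y => ?_
  simp [indicator]

lemma lintegral_indicator_norm_shell (k : ℕ) :
    ∫⁻ y : Plane, (Ico √(k : ℝ) √((k + 1 : ℕ) : ℝ)).indicator (1 : ℝ → ENNReal) ‖y‖ = ENNReal.ofReal Real.pi := by
  have hsq : ∀ n : ℕ, ENNReal.ofReal √(n : ℝ) ^ 2 = n := fun n => by
    rw [← ENNReal.ofReal_pow (Real.sqrt_nonneg _), Real.sq_sqrt n.cast_nonneg,
      ENNReal.ofReal_natCast]
  have hk : √(k : ℝ) ≤ √((k + 1 : ℕ) : ℝ) := Real.sqrt_le_sqrt (by simp)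
  have hadd : (∫⁻ y : Plane, (Iio √(k : ℝ)).indicator (1 : ℝ → ENNReal) ‖y‖) +
      ∫⁻ y : Plane, (Ico √(k : ℝ) √((k + 1 : ℕ) : ℝ)).indicator (1 : ℝ → ENNReal) ‖y‖ =
      ∫⁻ y : Plane, (Iio √((k + 1 : ℕ) : ℝ)).indicator (1 : ℝ → ENNReal) ‖y‖ := by
    have hm : Measurable fun y : Plane => (Iio √(k : ℝ)).indicator (1 : ℝ → ENNReal) ‖y‖ :=
      (measurable_one.indicator measurableSet_Iio).comp measurable_norm
    rw [← lintegral_add_left hm]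
    refine lintegral_congr fun y => ?_
    rw [← Iio_union_Ico_eq_Iio hk, indicator_union_of_disjoint]
    exact Set.disjoint_left.2 fun x hx hx' => (not_lt.2 hx'.1) hx
  rw [lintegral_indicator_norm_lt, lintegral_indicator_norm_lt, hsq, hsq, Nat.cast_add (R := ENNReal), add_mul,
    Nat.cast_one, one_mul] at hadd
  exact (ENNReal.add_right_inj (ENNReal.mul_ne_top (by simp) (by simp))).1 hadd

lemma nearestDist_le {Ω : Type*} (X : ℕ → Ω → Plane) (ω : Ω) (i : ℕ) :
    nearestDist X ω ≤ ‖X i ω‖ :=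
  ciInf_le ⟨0, by rintro _ ⟨i, rfl⟩; exact norm_nonneg _⟩ i

lemma nearestDist_nonneg {Ω : Type*} (X : ℕ → Ω → Plane) (ω : Ω) : 0 ≤ nearestDist X ω :=
  Real.iInf_nonneg fun _ => norm_nonneg _

/-- The mean number of points that either lie within distance `r` of the origin or lie farther away
and survive a thinning with retention probability `p`, for unit intensity. -/
noncomputable def thinnedMean (p : ℝ → ENNReal) (r : ℝ) : ENNReal :=
  ∫⁻ y : Plane, ((Iio r).indicator 1 ‖y‖ + (Ioi r).indicator p ‖y‖)

lemma thinnedMean_eq {p : ℝ → ENNReal} (hp : Measurable p) {r : ℝ} (hr : 0 ≤ r) :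
    thinnedMean p r = ENNReal.ofReal (Real.pi * r ^ 2) +
      ∫⁻ x in Ioi r, ENNReal.ofReal (2 * Real.pi * x) * p x := by
  rw [thinnedMean, lintegral_add_left (by
      exact (measurable_one.indicator measurableSet_Iio).comp measurable_norm),
    lintegral_indicator_norm_lt, lintegral_fun_norm_plane (hp.indicator measurableSet_Ioi)]
  congr 1
  · rw [← ENNReal.ofReal_pow hr, mul_comm, ENNReal.ofReal_mul Real.pi_pos.le]
  · rw [← lintegral_indicator measurableSet_Ioi, ← lintegral_indicator measurableSet_Ioi]
    refine lintegral_congr fun x => ?_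
    by_cases hx : r < x
    · simp [hx, hr.trans_lt hx]
    · simp [hx]

/-- The load `ψ`, modified near the origin: infinite in the disc of radius `√k`, zero in the annulus
between the radii `√k` and `√(k + 1)`. -/
noncomputable def shellLoad {S : Type*} (ψ : ℝ → ℝ × S → ENNReal) (k : ℕ) (y : Plane)
    (m : ℝ × S) : ENNReal :=
  if ‖y‖ < √(k : ℝ) then ⊤ else if ‖y‖ < √((k + 1 : ℕ) : ℝ) then 0 else ψ ‖y‖ m

lemma measurable_shellLoad {S : Type*} [MeasurableSpace S] {ψ : ℝ → ℝ × S → ENNReal}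
    (hψ : Measurable (Function.uncurry ψ)) (k : ℕ) :
    Measurable (Function.uncurry (shellLoad ψ k)) := by
  have hn : Measurable fun z : Plane × (ℝ × S) => ‖z.1‖ := measurable_fst.norm
  refine Measurable.ite (measurableSet_lt hn measurable_const) measurable_const
    (Measurable.ite (measurableSet_lt hn measurable_const) measurable_const ?_)
  exact hψ.comp (hn.prodMk measurable_snd)

/-- The term k = ⌊r₀²⌋ alone suffices: no point lies within √k, and a point at distance at least
√(k+1) is farther than r₀. The other terms are nonnegative. -/
lemma expNeg_nearest_le_tsum_shellLoad {Ω S : Type*} (ψ : ℝ → ℝ × S → ENNReal)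
    (X : ℕ → Ω → Plane) (M : ℕ → Ω → ℝ × S) (ω : Ω) :
    expNeg (∑' i, if nearestDist X ω < ‖X i ω‖ then ψ ‖X i ω‖ (M i ω) else 0) ≤
      ∑' k, expNeg (∑' i, shellLoad ψ k (X i ω) (M i ω)) := by
  set d := nearestDist X ω
  have hd0 : 0 ≤ d := nearestDist_nonneg X ω
  refine le_trans (expNeg_antitone (ENNReal.tsum_le_tsum fun i => ?_))
    (ENNReal.le_tsum ⌊d ^ 2⌋₊)
  have h1 : ¬ ‖X i ω‖ < √(⌊d ^ 2⌋₊ : ℝ) :=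
    not_lt.2 ((Real.sqrt_le_iff.2 ⟨hd0, Nat.floor_le (sq_nonneg d)⟩).trans (nearestDist_le X ω i))
  have h2 : d < √((⌊d ^ 2⌋₊ + 1 : ℕ) : ℝ) := by
    refine (Real.lt_sqrt hd0).2 ?_
    rw [Nat.cast_add, Nat.cast_one]
    exact Nat.lt_floor_add_one (d ^ 2)
  simp only [shellLoad, h1, if_false]
  by_cases h3 : ‖X i ω‖ < √((⌊d ^ 2⌋₊ + 1 : ℕ) : ℝ)
  · rw [if_pos h3]; exact zero_le
  · rw [if_neg h3, if_pos (h2.trans_le (not_lt.1 h3))]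

/-- Off the shell the two integrands agree; the infinite load on the disc gives 1 - e^{-∞} = 1. On
the shell the left integrand is at most 1, and the area is π. -/
lemma thinnedMean_le {S : Type*} [MeasurableSpace S] (ρ : Measure (ℝ × S))
    [IsProbabilityMeasure ρ] (ψ : ℝ → ℝ × S → ENNReal) {k : ℕ} {r : ℝ}
    (hr : r ∈ Ico √(k : ℝ) √((k + 1 : ℕ) : ℝ)) :
    thinnedMean (fun x => 1 - ∫⁻ m, expNeg (ψ x m) ∂ρ) r ≤
      (∫⁻ y, (1 - ∫⁻ m, expNeg (shellLoad ψ k y m) ∂ρ)) + ENNReal.ofReal Real.pi := by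
  have hm : Measurable fun y : Plane =>
      (Ico √(k : ℝ) √((k + 1 : ℕ) : ℝ)).indicator (1 : ℝ → ENNReal) ‖y‖ :=
    (measurable_one.indicator measurableSet_Ico).comp measurable_norm
  rw [← lintegral_indicator_norm_shell k, ← lintegral_add_right _ hm]
  refine lintegral_mono fun y => ?_
  rcases lt_or_ge ‖y‖ √(k : ℝ) with h | h
  · have h' : ‖y‖ < r := h.trans_le hr.1
    simp [shellLoad, h, h', h'.le]
  rcases lt_or_ge ‖y‖ √((k + 1 : ℕ) : ℝ) with h' | h'
  · refine le_trans ?_ le_add_self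
    rw [indicator_of_mem (s := Ico _ _) ⟨h, h'⟩]
    rcases lt_trichotomy ‖y‖ r with h | h | h
    · simp [h, h.le]
    · simp [h]
    · simp [h, h.le]
  · have h1 : r < ‖y‖ := hr.2.trans_le h'
    simp only [shellLoad, not_lt.2 h, not_lt.2 h', if_false]
    rw [indicator_of_notMem (by simpa using h1.le), indicator_of_mem (s := Ioi r) h1, zero_add]
    exact le_self_add

lemma lintegral_shell_weight (k : ℕ) :
    ∫⁻ r in Ico √(k : ℝ) √((k + 1 : ℕ) : ℝ), ENNReal.ofReal (2 * Real.pi * r)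
      ∂(volume.restrict (Ioi 0)) = ENNReal.ofReal Real.pi := by
  rw [← lintegral_indicator measurableSet_Ico, ← lintegral_indicator_norm_shell k,
    lintegral_fun_norm_plane (measurable_one.indicator measurableSet_Ico)]
  refine lintegral_congr fun r => ?_
  by_cases hr : r ∈ Ico √(k : ℝ) √((k + 1 : ℕ) : ℝ)
  · rw [indicator_of_mem hr, indicator_of_mem hr]; simp
  · rw [indicator_of_notMem hr, indicator_of_notMem hr]; simp

/-- The factor lost in bounding the Laplace functional of the points beyond the nearest one. -/
noncomputable def shellConst (lam : ℝ) : ENNReal :=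
  (expNeg (ENNReal.ofReal lam * ENNReal.ofReal Real.pi) *
    (ENNReal.ofReal lam * ENNReal.ofReal Real.pi))⁻¹

lemma shellConst_lt_top {lam : ℝ} (hlam : 0 < lam) : shellConst lam < ⊤ := by
  rw [shellConst, ENNReal.inv_lt_top, ← ENNReal.ofReal_mul hlam.le, expNeg_ofReal (by positivity),
    ← ENNReal.ofReal_mul (by positivity), ENNReal.ofReal_pos]
  positivity

/-- The shell has weight λπ under 2πλr dr, so a constant is λπ times smaller than its integral there
after normalisation; the integrands are then compared pointwise at the cost of e^{λπ}. -/
lemma IsNetwork.lintegral_expNeg_shellLoad_le {Ω S : Type*} [MeasurableSpace Ω]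
    [MeasurableSpace S] {P : Measure Ω} [IsProbabilityMeasure P] {lam : ℝ} (hlam : 0 < lam)
    {μ : Measure ℝ} {ν : Measure S} [IsProbabilityMeasure μ] [IsProbabilityMeasure ν]
    {X : ℕ → Ω → Plane} {M : ℕ → Ω → ℝ × S}
    (hN : IsNetwork P lam μ ν X M) {ψ : ℝ → ℝ × S → ENNReal}
    (hψ : Measurable (Function.uncurry ψ)) (k : ℕ) :
    ∫⁻ ω, expNeg (∑' i, shellLoad ψ k (X i ω) (M i ω)) ∂P ≤ shellConst lam *
      ∫⁻ r in Ico √(k : ℝ) √((k + 1 : ℕ) : ℝ),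
        ENNReal.ofReal lam * (ENNReal.ofReal (2 * Real.pi * r) * expNeg (ENNReal.ofReal lam *
          thinnedMean (fun x => 1 - ∫⁻ m, expNeg (ψ x m) ∂(μ.prod ν)) r))
        ∂(volume.restrict (Ioi 0)) := by
  refine (hN.lintegral_expNeg_tsum_le (measurable_shellLoad hψ k)).trans ?_
  set I := ∫⁻ y, (1 - ∫⁻ m, expNeg (shellLoad ψ k y m) ∂(μ.prod ν))
  set c := ENNReal.ofReal lam * ENNReal.ofReal Real.pi with hc
  have hC0 : expNeg c * c ≠ 0 := fun h => (shellConst_lt_top hlam).ne (by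
    rw [shellConst, ← hc, h, ENNReal.inv_zero])
  have hctop : expNeg c * c ≠ ⊤ := ENNReal.mul_ne_top
    (ne_top_of_le_ne_top ENNReal.one_ne_top (expNeg_le_one _)) (ENNReal.mul_ne_top (by simp) (by simp))
  rw [shellConst, ← hc, ← ENNReal.div_eq_inv_mul,
    ENNReal.le_div_iff_mul_le (Or.inl hC0) (Or.inl hctop)]
  calc expNeg (ENNReal.ofReal lam * I) * (expNeg c * c)
      = c * expNeg (ENNReal.ofReal lam * I + c) := by rw [expNeg_add]; ring
    _ = ∫⁻ r in Ico √(k : ℝ) √((k + 1 : ℕ) : ℝ), ENNReal.ofReal lam *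
          ENNReal.ofReal (2 * Real.pi * r) * expNeg (ENNReal.ofReal lam * I + c)
          ∂(volume.restrict (Ioi 0)) := by
        rw [lintegral_mul_const _ (by fun_prop), lintegral_const_mul _ (by fun_prop),
          lintegral_shell_weight]
    _ ≤ _ := by
        refine setLIntegral_mono' measurableSet_Ico fun r hr => ?_
        rw [mul_assoc]
        refine mul_le_mul_right (mul_le_mul_right (expNeg_antitone ?_) _) _
        rw [hc, ← mul_add]
        exact mul_le_mul_right (thinnedMean_le _ _ hr) _

lemma IsNetwork.measurable_expNeg_tsum {Ω S : Type*} [MeasurableSpace Ω] [MeasurableSpace S]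
    {P : Measure Ω} {lam : ℝ} {μ : Measure ℝ} {ν : Measure S}
    {X : ℕ → Ω → Plane} {M : ℕ → Ω → ℝ × S} (hN : IsNetwork P lam μ ν X M)
    {φ : Plane → ℝ × S → ENNReal} (hφ : Measurable (Function.uncurry φ)) :
    Measurable fun ω => expNeg (∑' i, φ (X i ω) (M i ω)) :=
  measurable_expNeg.comp (Measurable.tsum fun i =>
    hφ.comp ((hN.poisson.measurable i).prodMk (hN.measurable_mark i)))

/-- A bound for the Laplace functional of the points farther away than the nearest one. -/
lemma IsNetwork.lintegral_expNeg_nearest_le {Ω S : Type*} [MeasurableSpace Ω] [MeasurableSpace S]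
    {P : Measure Ω} [IsProbabilityMeasure P] {lam : ℝ} (hlam : 0 < lam)
    {μ : Measure ℝ} {ν : Measure S} [IsProbabilityMeasure μ] [IsProbabilityMeasure ν]
    {X : ℕ → Ω → Plane} {M : ℕ → Ω → ℝ × S}
    (hN : IsNetwork P lam μ ν X M) {ψ : ℝ → ℝ × S → ENNReal}
    (hψ : Measurable (Function.uncurry ψ)) :
    ∫⁻ ω, expNeg (∑' i, if nearestDist X ω < ‖X i ω‖ then ψ ‖X i ω‖ (M i ω) else 0) ∂P ≤
      shellConst lam * ∫⁻ r in Ioi (0 : ℝ), ENNReal.ofReal lam *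
        (ENNReal.ofReal (2 * Real.pi * r) * expNeg (ENNReal.ofReal lam *
          thinnedMean (fun x => 1 - ∫⁻ m, expNeg (ψ x m) ∂(μ.prod ν)) r)) := by
  have hdisj : Pairwise (Function.onFun Disjoint fun k : ℕ => Ico √(k : ℝ) √((k + 1 : ℕ) : ℝ)) := by
    have hmono : Monotone fun k : ℕ => √(k : ℝ) := fun a b hab =>
      Real.sqrt_le_sqrt (by exact_mod_cast hab)
    exact hmono.pairwise_disjoint_on_Ico_succ
  have hmeas : ∀ k, Measurable fun ω => expNeg (∑' i, shellLoad ψ k (X i ω) (M i ω)) := fun k =>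
    hN.measurable_expNeg_tsum (measurable_shellLoad hψ k)
  refine (lintegral_mono (expNeg_nearest_le_tsum_shellLoad ψ X M)).trans ?_
  rw [lintegral_tsum fun k => (hmeas k).aemeasurable]
  refine (ENNReal.tsum_le_tsum (hN.lintegral_expNeg_shellLoad_le hlam hψ)).trans ?_
  rw [ENNReal.tsum_mul_left, ← lintegral_iUnion (fun k => measurableSet_Ico) hdisj]
  exact mul_le_mul_right (setLIntegral_le_lintegral _ _) _

/-- Without integrability the left side is the default value 0, so the inequality survives. -/
lemma ofReal_integral_le_lintegral_ofReal {α : Type*} [MeasurableSpace α] {μ : Measure α}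
    {f : α → ℝ} (hf : 0 ≤ᵐ[μ] f) :
    ENNReal.ofReal (∫ x, f x ∂μ) ≤ ∫⁻ x, ENNReal.ofReal (f x) ∂μ := by
  by_cases h : Integrable f μ
  · exact (ofReal_integral_eq_lintegral_ofReal h hf).le
  · simp [integral_undef h]

/-- The form in which the two conditions are stated. A lower bound `p` is enough because it enters
with a negative sign; a divergent inner integral, read as 0, only enlarges the right side. -/
lemma IsNetwork.lintegral_expNeg_nearest_le_real {Ω S : Type*} [MeasurableSpace Ω]
    [MeasurableSpace S] {P : Measure Ω} [IsProbabilityMeasure P] {lam : ℝ} (hlam : 0 < lam)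
    {μ : Measure ℝ} {ν : Measure S} [IsProbabilityMeasure μ] [IsProbabilityMeasure ν]
    {X : ℕ → Ω → Plane} {M : ℕ → Ω → ℝ × S}
    (hN : IsNetwork P lam μ ν X M) {ψ : ℝ → ℝ × S → ENNReal}
    (hψ : Measurable (Function.uncurry ψ)) {p : ℝ → ℝ} (hp0 : ∀ x, 0 < x → 0 ≤ p x)
    (hp : ∀ x, 0 < x → ENNReal.ofReal (p x) ≤ ∫⁻ m, (1 - expNeg (ψ x m)) ∂(μ.prod ν)) :
    ∫⁻ ω, expNeg (∑' i, if nearestDist X ω < ‖X i ω‖ then ψ ‖X i ω‖ (M i ω) else 0) ∂P ≤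
      shellConst lam * ∫⁻ r in Ioi (0 : ℝ), ENNReal.ofReal (2 * Real.pi * lam * r *
        Real.exp (-Real.pi * lam * r ^ 2 - 2 * Real.pi * lam * ∫ x in Ioi r, x * p x)) := by
  refine (hN.lintegral_expNeg_nearest_le hlam hψ).trans ?_
  refine mul_le_mul_right (setLIntegral_mono' measurableSet_Ioi fun r (hr : 0 < r) => ?_) _
  have hpi := Real.pi_pos
  have hpm : Measurable fun x => 1 - ∫⁻ m, expNeg (ψ x m) ∂(μ.prod ν) :=
    measurable_const.sub (Measurable.lintegral_prod_right' (measurable_expNeg.comp hψ))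
  rw [← mul_assoc, ← ENNReal.ofReal_mul hlam.le,
    show lam * (2 * Real.pi * r) = 2 * Real.pi * lam * r by ring,
    show -Real.pi * lam * r ^ 2 - 2 * Real.pi * lam * ∫ x in Ioi r, x * p x =
      -(lam * (Real.pi * r ^ 2 + ∫ x in Ioi r, 2 * Real.pi * (x * p x))) by
        rw [integral_const_mul]; ring,
    ENNReal.ofReal_mul (p := 2 * Real.pi * lam * r) (by positivity)]
  refine mul_le_mul_right (expNeg_le_ofReal_exp ?_) _
  rw [ENNReal.ofReal_mul hlam.le, thinnedMean_eq hpm hr.le]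
  refine mul_le_mul_right (ENNReal.ofReal_add_le.trans (add_le_add_right ?_ _)) _
  refine (ofReal_integral_le_lintegral_ofReal ?_).trans
    (setLIntegral_mono' measurableSet_Ioi fun x (hx : r < x) => ?_)
  · filter_upwards [ae_restrict_mem measurableSet_Ioi] with x (hx : r < x)
    have := hp0 x (hr.trans hx)
    have := hr.trans hx
    positivity
  · have hx0 := hr.trans hx
    rw [← mul_assoc, ENNReal.ofReal_mul (by positivity)]
    refine mul_le_mul_right ((hp x hx0).trans_eq ?_) _
    have hm : Measurable fun m => expNeg (ψ x m) :=
      measurable_expNeg.comp (hψ.comp measurable_prodMk_left)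
    rw [lintegral_sub hm (ne_top_of_le_ne_top ENNReal.one_ne_top
      (by simpa using lintegral_mono (μ := μ.prod ν) fun m => expNeg_le_one (ψ x m)))
      (ae_of_all _ fun m => expNeg_le_one _)]
    simp

/-! ### Integral bounds for the negative moment -/

/-- For finite positive x this is the Gamma integral with Γ(2) = 1; at x = 0 the right side diverges
too. -/
lemma inv_sq_le_lintegral_mul_expNeg (x : ENNReal) :
    x⁻¹ ^ 2 ≤ ∫⁻ t in Ioi (0 : ℝ), ENNReal.ofReal t * expNeg (ENNReal.ofReal t * x) := by
  rcases eq_or_ne x ⊤ with rfl | hx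
  · simp
  rcases eq_or_ne x 0 with rfl | hx0
  · have h1 : ∫⁻ t in Ioi (1 : ℝ), (1 : ENNReal) = ⊤ := by simp
    have h2 : ∫⁻ t in Ioi (1 : ℝ), (1 : ENNReal) ≤
        ∫⁻ t in Ioi (0 : ℝ), ENNReal.ofReal t * expNeg (ENNReal.ofReal t * 0) :=
      (setLIntegral_mono' measurableSet_Ioi fun t (ht : 1 < t) => by simpa using ht.le).trans
        (lintegral_mono_set (Ioi_subset_Ioi zero_le_one))
    rw [h1, top_le_iff] at h2
    rw [h2]
    exact le_top
  obtain ⟨a, ha, rfl⟩ : ∃ a : ℝ, 0 < a ∧ x = ENNReal.ofReal a :=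
    ⟨x.toReal, ENNReal.toReal_pos hx0 hx, (ENNReal.ofReal_toReal hx).symm⟩
  have hint : ∫ t in Ioi (0 : ℝ), t * Real.exp (-(a * t)) = a⁻¹ ^ 2 := by
    have h := Real.integral_rpow_mul_exp_neg_mul_Ioi (a := 2) (r := a) two_pos ha
    rw [Real.Gamma_two, mul_one, one_div, Real.rpow_two] at h
    rw [← h]
    norm_num
  rw [← ENNReal.ofReal_inv_of_pos ha, ← ENNReal.ofReal_pow (by positivity), ← hint]
  refine (ofReal_integral_le_lintegral_ofReal ?_).trans_eq
    (setLIntegral_congr_fun measurableSet_Ioi fun t (ht : 0 < t) => ?_)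
  · filter_upwards [ae_restrict_mem measurableSet_Ioi] with t (ht : 0 < t)
    positivity
  · rw [← ENNReal.ofReal_mul ht.le, expNeg_ofReal (by positivity), ENNReal.ofReal_mul ht.le,
      mul_comm a]

lemma le_lintegral_indicator_ofReal_lt (c : ENNReal) :
    c ≤ ∫⁻ t in Ioi (0 : ℝ), if ENNReal.ofReal t < c then 1 else 0 := by
  rcases eq_or_ne c ⊤ with rfl | hc
  · simp
  · calc c = ∫⁻ t in Ioo (0 : ℝ) c.toReal, 1 := by simp [ENNReal.ofReal_toReal hc]
      _ ≤ ∫⁻ t in Ioo (0 : ℝ) c.toReal, if ENNReal.ofReal t < c then 1 else 0 :=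
        setLIntegral_mono' measurableSet_Ioo fun t ht => by
          rw [if_pos ((ENNReal.ofReal_lt_iff_lt_toReal ht.1.le hc).2 ht.2)]
      _ ≤ _ := lintegral_mono_set Ioo_subset_Ioi_self

/-! ### The two sufficient conditions -/

lemma IsNetwork.measurable_interference {Ω S : Type*} [MeasurableSpace Ω] [MeasurableSpace S]
    {P : Measure Ω} {lam : ℝ} {μ : Measure ℝ} {ν : Measure S} {L : S → ℝ → ℝ}
    (hL : Measurable (Function.uncurry L)) {X : ℕ → Ω → Plane} {M : ℕ → Ω → ℝ × S}
    (hN : IsNetwork P lam μ ν X M) : Measurable (interference L X M) := by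
  have hX := fun i => (hN.poisson.measurable i).norm
  have hM := hN.measurable_mark
  refine Measurable.tsum fun i => Measurable.ite
    (measurableSet_lt (Measurable.iInf hX) (hX i)) ?_ measurable_const
  exact ((hM i).fst.mul (hL.comp ((hM i).snd.prodMk (hX i)))).ennreal_ofReal

lemma measurable_signal {S : Type*} [MeasurableSpace S] {L : S → ℝ → ℝ}
    (hL : Measurable (Function.uncurry L)) :
    Measurable fun z : ℝ × (ℝ × S) => z.2.1 * L z.2.2 z.1 :=
  measurable_snd.fst.mul (hL.comp (measurable_snd.snd.prodMk measurable_fst))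

/-- Fading gains and path losses are almost surely nonnegative. -/
lemma IsFeasiblePathLoss.ae_nonneg {S : Type*} [MeasurableSpace S] {μ : Measure ℝ}
    [IsProbabilityMeasure μ] (hμ : ∀ᵐ y ∂μ, 0 ≤ y) {ν : Measure S} [IsProbabilityMeasure ν]
    {L : S → ℝ → ℝ} (hL : IsFeasiblePathLoss ν L) :
    ∀ᵐ m ∂(μ.prod ν), 0 ≤ m.1 ∧ ∀ r, 0 ≤ r → 0 ≤ L m.2 r := by
  obtain ⟨L₀, hL₀⟩ := hL.bounded
  filter_upwards [Measure.quasiMeasurePreserving_fst.ae hμ,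
    Measure.quasiMeasurePreserving_snd.ae hL₀] with m h1 h2
  exact ⟨h1, fun r hr => (h2.2 r hr).1⟩

lemma IsNetwork.secondNegMoment_le_laplaceIntegral {Ω S : Type*} [MeasurableSpace Ω]
    [MeasurableSpace S] {P : Measure Ω} [IsProbabilityMeasure P] {lam : ℝ} (hlam : 0 < lam)
    {μ : Measure ℝ} [IsProbabilityMeasure μ] (hμ : ∀ᵐ y ∂μ, 0 ≤ y)
    {ν : Measure S} [IsProbabilityMeasure ν] {L : S → ℝ → ℝ} (hL : IsFeasiblePathLoss ν L)
    {X : ℕ → Ω → Plane} {M : ℕ → Ω → ℝ × S} (hN : IsNetwork P lam μ ν X M) :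
    secondNegMoment P L X M ≤ shellConst lam * laplaceIntegral μ ν L lam := by
  have hI := hN.measurable_interference hL.measurable
  have hae := hL.ae_nonneg hμ
  have hlaplace : ∀ t : ℝ, 0 < t →
      ∫⁻ ω, expNeg (ENNReal.ofReal t * interference L X M ω) ∂P ≤ shellConst lam *
        ∫⁻ r in Ioi (0 : ℝ), ENNReal.ofReal (2 * Real.pi * lam * r *
          Real.exp (-Real.pi * lam * r ^ 2 - 2 * Real.pi * lam *
            ∫ x in Ioi r, x * ∫ m : ℝ × S, (1 - Real.exp (-(m.1 * t * L m.2 x)))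
              ∂(μ.prod ν))) := fun t ht => by
    let ψ : ℝ → ℝ × S → ENNReal := fun x m => ENNReal.ofReal t * ENNReal.ofReal (m.1 * L m.2 x)
    have hψ : Measurable (Function.uncurry ψ) :=
      (measurable_signal hL.measurable).ennreal_ofReal.const_mul _
    have hsum : ∀ ω, ENNReal.ofReal t * interference L X M ω =
        ∑' i, if nearestDist X ω < ‖X i ω‖ then ψ ‖X i ω‖ (M i ω) else 0 := fun ω => by
      simp [interference, ← ENNReal.tsum_mul_left, ψ]
    simp_rw [hsum]
    refine hN.lintegral_expNeg_nearest_le_real hlam hψ (fun x hx => ?_) fun x hx => ?_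
    · refine integral_nonneg_of_ae ?_
      filter_upwards [hae] with m hm
      have := mul_nonneg (mul_nonneg hm.1 ht.le) (hm.2 x hx.le)
      simpa using this
    -- Gains and path losses are nonnegative only almost surely, so the real and extended
    -- exponentials agree only almost everywhere.
    · refine (ofReal_integral_le_lintegral_ofReal ?_).trans_eq (lintegral_congr_ae ?_)
      · filter_upwards [hae] with m hm
        have := mul_nonneg (mul_nonneg hm.1 ht.le) (hm.2 x hx.le)
        simpa using this
      · filter_upwards [hae] with m hm
        have := mul_nonneg hm.1 (hm.2 x hx.le)
        simp only [ψ]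
        rw [← ENNReal.ofReal_mul ht.le, expNeg_ofReal (by positivity), ENNReal.ofReal_sub _
          (Real.exp_pos _).le, ENNReal.ofReal_one,
          show m.1 * t * L m.2 x = t * (m.1 * L m.2 x) by ring]
  calc secondNegMoment P L X M
      ≤ ∫⁻ ω, (∫⁻ t in Ioi (0 : ℝ), ENNReal.ofReal t *
          expNeg (ENNReal.ofReal t * interference L X M ω)) ∂P :=
        lintegral_mono fun ω => inv_sq_le_lintegral_mul_expNeg _
    _ = ∫⁻ t in Ioi (0 : ℝ), (∫⁻ ω, ENNReal.ofReal t *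
          expNeg (ENNReal.ofReal t * interference L X M ω) ∂P) := by
        refine lintegral_lintegral_swap (Measurable.aemeasurable ?_)
        have h : Measurable fun z : Ω × ℝ => ENNReal.ofReal z.2 := by fun_prop
        exact h.mul (measurable_expNeg.comp (h.mul (hI.comp measurable_fst)))
    _ ≤ ∫⁻ t in Ioi (0 : ℝ), shellConst lam * ∫⁻ r in Ioi (0 : ℝ), ENNReal.ofReal
          (2 * Real.pi * lam * r * t *
            Real.exp (-Real.pi * lam * r ^ 2 - 2 * Real.pi * lam *
              ∫ x in Ioi r, x * ∫ m : ℝ × S, (1 - Real.exp (-(m.1 * t * L m.2 x)))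
                ∂(μ.prod ν))) := by
        refine setLIntegral_mono' measurableSet_Ioi fun t (ht : 0 < t) => ?_
        rw [lintegral_const_mul' _ _ ENNReal.ofReal_ne_top]
        refine (mul_le_mul_right (hlaplace t ht) _).trans_eq ?_
        rw [mul_left_comm, ← lintegral_const_mul' _ _ ENNReal.ofReal_ne_top]
        congr 2 with r
        rw [← ENNReal.ofReal_mul ht.le]
        congr 1
        ring
    _ = shellConst lam * laplaceIntegral μ ν L lam :=
        lintegral_const_mul' _ _ (shellConst_lt_top hlam).ne

lemma IsNetwork.secondNegMoment_le_tailIntegral {Ω S : Type*} [MeasurableSpace Ω]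
    [MeasurableSpace S] {P : Measure Ω} [IsProbabilityMeasure P] {lam : ℝ} (hlam : 0 < lam)
    {μ : Measure ℝ} [IsProbabilityMeasure μ] {ν : Measure S} [IsProbabilityMeasure ν]
    {L : S → ℝ → ℝ} (hL : Measurable (Function.uncurry L))
    {X : ℕ → Ω → Plane} {M : ℕ → Ω → ℝ × S} (hN : IsNetwork P lam μ ν X M) :
    secondNegMoment P L X M ≤ shellConst lam * tailIntegral μ ν L lam := by
  have hI := hN.measurable_interference hL
  have htail : ∀ t : ℝ, 0 < t →
      ∫⁻ ω, (if ENNReal.ofReal t < (interference L X M ω)⁻¹ ^ 2 then 1 else 0) ∂P ≤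
        shellConst lam * ∫⁻ r in Ioi (0 : ℝ), ENNReal.ofReal (2 * Real.pi * lam * r *
          Real.exp (-Real.pi * lam * r ^ 2 - 2 * Real.pi * lam *
            ∫ x in Ioi r, x * (μ.prod ν).real
              {m : ℝ × S | L m.2 x * m.1 ≥ 1 / Real.sqrt t})) := fun t ht => by
    have hst := Real.sqrt_pos.2 ht
    -- An infinite load on each signal of size at least 1/√t makes the exponential the indicator
    -- that no such signal comes from beyond r₀.
    let ψ : ℝ → ℝ × S → ENNReal := fun x m => if 1 / √t ≤ m.1 * L m.2 x then ⊤ else 0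
    have hψ : Measurable (Function.uncurry ψ) :=
      Measurable.ite (measurableSet_le measurable_const (measurable_signal hL)) measurable_const
        measurable_const
    refine le_trans (lintegral_mono fun ω => ?_) (hN.lintegral_expNeg_nearest_le_real hlam hψ
      (fun x hx => measureReal_nonneg) fun x hx => ?_)
    · split_ifs with h
      -- I⁻² > t means I < 1/√t, and every summand is at most I.
      · have hsmall : interference L X M ω < ENNReal.ofReal (1 / √t) := by
          rw [one_div, ENNReal.ofReal_inv_of_pos hst, ← ENNReal.inv_lt_inv, inv_inv]
          rw [← Real.sq_sqrt ht.le, ENNReal.ofReal_pow hst.le] at h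
          exact lt_of_not_ge fun h' => h.not_ge (pow_le_pow_left' h' 2)
        have hzero : (∑' i, if nearestDist X ω < ‖X i ω‖ then ψ ‖X i ω‖ (M i ω) else 0) = 0 := by
          refine ENNReal.tsum_eq_zero.2 fun i => ?_
          split_ifs with hi
          · have hterm : ENNReal.ofReal ((M i ω).1 * L (M i ω).2 ‖X i ω‖) ≤
                interference L X M ω := by
              refine le_trans ?_ (ENNReal.le_tsum i)
              rw [if_pos hi]
            exact if_neg fun hle =>
              (hterm.trans_lt hsmall).not_ge (ENNReal.ofReal_le_ofReal hle)
          · rfl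
        rw [hzero, expNeg_zero]
      · exact zero_le
    · have hm : Measurable fun m : ℝ × S => m.1 * L m.2 x :=
        (measurable_signal hL).comp measurable_prodMk_left
      have hset : MeasurableSet {m : ℝ × S | L m.2 x * m.1 ≥ 1 / √t} := by
        simp_rw [mul_comm (L _ x)]
        exact measurableSet_le measurable_const hm
      rw [ofReal_measureReal, ← lintegral_indicator_one hset]
      refine lintegral_mono fun m => ?_
      by_cases h : 1 / √t ≤ m.1 * L m.2 x
      · simp only [ψ, if_pos h, expNeg_top, tsub_zero]
        exact indicator_le_self _ _ _
      · rw [indicator_of_notMem (by rwa [mem_ofPred_eq, mul_comm])]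
        exact zero_le
  calc secondNegMoment P L X M
      ≤ ∫⁻ ω, (∫⁻ t in Ioi (0 : ℝ),
          if ENNReal.ofReal t < (interference L X M ω)⁻¹ ^ 2 then 1 else 0) ∂P :=
        lintegral_mono fun ω => le_lintegral_indicator_ofReal_lt _
    _ = ∫⁻ t in Ioi (0 : ℝ), (∫⁻ ω,
          (if ENNReal.ofReal t < (interference L X M ω)⁻¹ ^ 2 then 1 else 0) ∂P) := by
        refine lintegral_lintegral_swap (Measurable.aemeasurable ?_)
        have h : Measurable fun z : Ω × ℝ => ENNReal.ofReal z.2 := by fun_prop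
        exact Measurable.ite (measurableSet_lt h ((hI.comp measurable_fst).inv.pow_const 2))
          measurable_const measurable_const
    _ ≤ ∫⁻ t in Ioi (0 : ℝ), shellConst lam * _ :=
        setLIntegral_mono' measurableSet_Ioi htail
    _ = shellConst lam * tailIntegral μ ν L lam :=
        lintegral_const_mul' _ _ (shellConst_lt_top hlam).ne

theorem corollary1 {S : Type*} [MeasurableSpace S]
    (μ : Measure ℝ) [IsProbabilityMeasure μ] (hμ_nonneg : ∀ᵐ y ∂μ, 0 ≤ y)
    (hμ_mean : ∫ y, y ∂μ = 1)
    (ν : Measure S) [IsProbabilityMeasure ν]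
    (L : S → ℝ → ℝ) (hL : IsFeasiblePathLoss ν L)
    (lamc : ℝ) (hlamc : 0 ≤ lamc)
    (h : (∀ lam : ℝ, lamc ≤ lam → 0 < lam → laplaceIntegral μ ν L lam < ⊤) ∨
      (∀ lam : ℝ, lamc ≤ lam → 0 < lam → tailIntegral μ ν L lam < ⊤)) :
    ∀ lam : ℝ, lamc ≤ lam → 0 < lam →
      ∀ (Ω : Type*) [MeasurableSpace Ω] (P : Measure Ω) [IsProbabilityMeasure P]
        (X : ℕ → Ω → Plane) (M : ℕ → Ω → ℝ × S),
        IsNetwork P lam μ ν X M → secondNegMoment P L X M < ⊤ := by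
  intro lam hlc hlam Ω _ P _ X M hN
  have hC := shellConst_lt_top hlam
  rcases h with h | h
  · exact (hN.secondNegMoment_le_laplaceIntegral hlam hμ_nonneg hL).trans_lt
      (ENNReal.mul_lt_top hC (h lam hlc hlam))
  · exact (hN.secondNegMoment_le_tailIntegral hlam hL.measurable).trans_lt
      (ENNReal.mul_lt_top hC (h lam hlc hlam))
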